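/- Fix $0<p\le 1$. For a profinite set $S=\varprojlim_i S_i$ (finite discrete quotients $S_i$) let $$\mathcal M_{<p}(S)=\bigcup_{0<q<p}\ \bigcup_{c>0}\ \varprojlim_i \mathbb C[S_i]_{\ell^q\le c},\qquad \mathbb C[S_i]_{\ell^q\le c}=\Big\{(m_x)_{x\in S_i}:\ \sum_{x}|m_x|^q\le c\Big\},$$ regarded as a condensed $\mathbb C$-vector space (a module over the condensed ring $T\mapsto C(T,\mathbb C)$), with the map $S\to\mathcal M_{<p}(S)$, $s\mapsto\delta_s$. A condensed $\mathbb C$-vector space $W$ is called $p$-liquid if for every profinite set $S$ every map of condensed sets $S\to W$ extends, uniquely, along $S\to\mathcal M_{<p}(S)$ to a morphism of condensed $\mathbb C$-vector spaces $\mathcal M_{<p}(S)\to W$. Let $V$ be a complex Banach space, $T$ a bounded operator on $V$, and $\mathrm{End}(V)$ the Banach space of bounded operators on $V$ with the operator norm, viewed as the condensed $\mathbb C$-vector space $X\mapsto C(X,\mathrm{End}(V))$. Let $f(z)=\sum_{n\ge0}a_nz^n$ be an entire function and, for each $n$, let $\sqrt{a_n}$ be a chosen complex square root of $a_n$. Let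 $S=\mathbb N\cup\{\infty\}$, let $\varphi_{T,f}:S\to\mathrm{End}(V)$ be the (continuous) map $n\mapsto\sqrt{a_n}\,T^n$, $\infty\mapsto0$, and let $\mu_f=\sum_n\sqrt{a_n}\,\delta_n$ be the measure on $S$ with mass $\sqrt{a_n}$ at $n$ and mass $0$ at $\infty$, which is a point of $\mathcal M_{<p}(S)$. Then $\mathrm{End}(V)$ is $p$-liquid; hence $\varphi_{T,f}$ extends uniquely to a morphism of condensed $\mathbb C$-vector spaces $\widetilde{\varphi_{T,f}}:\mathcal M_{<p}(S)\to\mathrm{End}(V)$, and $$\widetilde{\varphi_{T,f}}(\mu_f)=f(T)=\sum_{n\ge0}a_nT^n,$$ where the series converges in the operator norm. -/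

import Mathlib

open CategoryTheory Opposite Topology Filter

universe u

namespace Liquid

/-! ### Condensed sets and condensed complex vector spaces -/

/-- Condensed sets: sheaves of sets for the coherent topology on compact Hausdorff spaces. -/
abbrev CondSet := Condensed.{u} (Type u)

/-- The functor sending a topological space `X` to the condensed set `T ↦ C(T, X)`. -/
noncomputable abbrev topToCond : TopCat.{u} ⥤ CondSet.{u} :=
  topCatToSheafCompHausLike.{u} _ (fun _ _ _ ↦ ((CompHaus.effectiveEpi_tfae _).out 0 2).mp)

theorem isSheaf_yonedaPresheaf (X : Type*) [TopologicalSpace X] :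
    Presheaf.IsSheaf (coherentTopology CompHaus.{u})
      (ContinuousMap.yonedaPresheaf (CompHausLike.compHausLikeToTop.{u} _) X) := by
  rw [Presheaf.isSheaf_iff_preservesFiniteProducts_and_equalizerCondition]
  refine ⟨inferInstance, ?_⟩
  apply +allowSynthFailures equalizerCondition_yonedaPresheaf
    (CompHausLike.compHausLikeToTop.{u} _) X
  intro Z B π he
  exact .of_surjective_continuous
    (((CompHaus.effectiveEpi_tfae _).out 0 2).mp he) π.hom.hom.continuous

/-- The presheaf of rings `T ↦ C(T, ℂ)`. -/
noncomputable def complexPresheaf : CompHaus.{u}ᵒᵖ ⥤ RingCat.{u} where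
  obj T := RingCat.of C(T.unop, ℂ)
  map f := RingCat.ofHom
    { toFun := fun g ↦ g.comp f.unop.hom.hom
      map_one' := rfl
      map_mul' := fun _ _ ↦ rfl
      map_zero' := rfl
      map_add' := fun _ _ ↦ rfl }

/-- The condensed ring `T ↦ C(T, ℂ)` attached to the topological field `ℂ`. -/
noncomputable def condComplex : Condensed.{u} RingCat.{u} where
  obj := complexPresheaf
  property :=
    Presheaf.isSheaf_coherent_of_hasPullbacks_of_comp _ (CategoryTheory.forget RingCat.{u})
      (isSheaf_yonedaPresheaf.{u, 0} ℂ)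

/-- Condensed `ℂ`-vector spaces: modules over the condensed ring `condComplex`. -/
abbrev CondVect := SheafOfModules.{u} condComplex.{u}

/-- The underlying condensed set of a condensed `ℂ`-vector space. -/
noncomputable def forgetCond : CondVect.{u} ⥤ CondSet.{u} :=
  SheafOfModules.toSheaf condComplex.{u} ⋙ sheafCompose _ (CategoryTheory.forget AddCommGrpCat.{u})

section OfTop

variable (X : Type u) [AddCommGroup X] [Module ℂ X] [TopologicalSpace X]
  [IsTopologicalAddGroup X] [ContinuousSMul ℂ X]

/-- The presheaf of abelian groups `T ↦ C(T, X)`. -/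
noncomputable def contPresheaf : CompHaus.{u}ᵒᵖ ⥤ Ab.{u} where
  obj T := AddCommGrpCat.of C(T.unop, X)
  map f := AddCommGrpCat.ofHom
    { toFun := fun g ↦ g.comp f.unop.hom.hom
      map_zero' := rfl
      map_add' := fun _ _ ↦ rfl }

noncomputable instance (T : CompHaus.{u}ᵒᵖ) :
    Module (condComplex.{u}.obj.obj T) ((contPresheaf X).obj T) :=
  inferInstanceAs (Module C(T.unop, ℂ) C(T.unop, X))

/-- The presheaf `T ↦ C(T, X)` with its pointwise `C(T, ℂ)`-module structures. -/
noncomputable def contPresheafOfModules : PresheafOfModules.{u} condComplex.{u}.obj :=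
  PresheafOfModules.ofPresheaf (contPresheaf X) (fun _ _ _ _ _ ↦ rfl)

/-- The condensed `ℂ`-vector space `T ↦ C(T, X)` attached to a topological `ℂ`-vector space. -/
noncomputable def condOfTop : CondVect.{u} where
  val := contPresheafOfModules X
  isSheaf :=
    Presheaf.isSheaf_coherent_of_hasPullbacks_of_comp _ (CategoryTheory.forget AddCommGrpCat.{u})
      (isSheaf_yonedaPresheaf.{u, u} X)

end OfTop

/-! ### The measure spaces `𝓜_{<p}(S)` -/

section Measures

variable (S : Type u) [TopologicalSpace S] [CompactSpace S]

noncomputable instance (i : DiscreteQuotient S) : Fintype i := Fintype.ofFinite _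

open Classical in
/-- The topological vector space `lim_i ℂ[S_i]`, where `S_i` runs through the finite discrete
quotients of `S` and the transition maps are the pushforwards `ℂ[S_i] → ℂ[S_j]`; it carries the
inverse limit topology. -/
def Meas : Submodule ℂ (∀ i : DiscreteQuotient S, i → ℂ) where
  carrier := {μ | ∀ (i j : DiscreteQuotient S) (h : i ≤ j) (y : j),
    ∑ x with DiscreteQuotient.ofLE h x = y, μ i x = μ j y}
  zero_mem' := by
    intro i j h y; simp
  add_mem' := by
    intro μ ν hμ hν i j h y
    simp [Finset.sum_add_distrib, hμ i j h y, hν i j h y]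
  smul_mem' := by
    intro c μ hμ i j h y
    simp [← Finset.mul_sum, hμ i j h y]

variable {S}

/-- `InBall q c μ` says that `μ` lies in `lim_i ℂ[S_i]_{ℓ^q ≤ c}`. -/
def InBall (q c : ℝ) (μ : Meas S) : Prop :=
  ∀ i : DiscreteQuotient S, ∑ x, ‖μ.1 i x‖ ^ q ≤ c

theorem InBall.zero {q : ℝ} (hq : 0 < q) : InBall q 0 (0 : Meas S) := by
  intro i
  simp [Real.zero_rpow hq.ne']

theorem InBall.nonneg {q c : ℝ} {μ : Meas S} (h : InBall q c μ) : 0 ≤ c :=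
  le_trans (Finset.sum_nonneg fun _ _ ↦ by positivity) (h ⊤)

theorem InBall.mono {q c d : ℝ} {μ : Meas S} (h : InBall q c μ) (hcd : c ≤ d) : InBall q d μ :=
  fun i ↦ (h i).trans hcd

theorem InBall.add {q c d : ℝ} (hq : 0 < q) (hq1 : q ≤ 1) {μ ν : Meas S}
    (hμ : InBall q c μ) (hν : InBall q d ν) : InBall q (c + d) (μ + ν) := by
  intro i
  refine le_trans ?_ (add_le_add (hμ i) (hν i))
  rw [← Finset.sum_add_distrib]
  refine Finset.sum_le_sum fun x _ ↦ ?_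
  calc ‖μ.1 i x + ν.1 i x‖ ^ q ≤ (‖μ.1 i x‖ + ‖ν.1 i x‖) ^ q :=
        Real.rpow_le_rpow (norm_nonneg _) (norm_add_le _ _) hq.le
    _ ≤ _ := mod_cast NNReal.rpow_add_le_add_rpow ‖μ.1 i x‖₊ ‖ν.1 i x‖₊ hq.le hq1

theorem InBall.smul {q c B : ℝ} (hq : 0 < q) {μ : Meas S} (hμ : InBall q c μ) {z : ℂ}
    (hz : ‖z‖ ≤ B) : InBall q (B ^ q * c) (z • μ) := by
  intro i
  have hB : 0 ≤ B := (norm_nonneg z).trans hz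
  calc ∑ x, ‖(z • μ).1 i x‖ ^ q = ∑ x, ‖z‖ ^ q * ‖μ.1 i x‖ ^ q := by
        refine Finset.sum_congr rfl fun x _ ↦ ?_
        rw [← Real.mul_rpow (norm_nonneg _) (norm_nonneg _), ← norm_mul]
        rfl
    _ = ‖z‖ ^ q * ∑ x, ‖μ.1 i x‖ ^ q := by rw [Finset.mul_sum]
    _ ≤ B ^ q * c := by
        refine mul_le_mul (Real.rpow_le_rpow (norm_nonneg _) hz hq.le) (hμ i)
          (Finset.sum_nonneg fun _ _ ↦ by positivity) (by positivity)

theorem InBall.exponent {q r c : ℝ} (hq : 0 < q) (hqr : q ≤ r) {μ : Meas S}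
    (hμ : InBall q c μ) : InBall r (c * c ^ ((r - q) / q)) μ := by
  intro i
  have hc := hμ.nonneg
  calc ∑ x, ‖μ.1 i x‖ ^ r ≤ ∑ x, ‖μ.1 i x‖ ^ q * c ^ ((r - q) / q) := by
        refine Finset.sum_le_sum fun x _ ↦ ?_
        have h1 : ‖μ.1 i x‖ ^ q ≤ c :=
          (Finset.single_le_sum (f := fun x ↦ ‖μ.1 i x‖ ^ q) (fun _ _ ↦ by positivity)
            (Finset.mem_univ x)).trans (hμ i)
        have h2 : ‖μ.1 i x‖ ^ (r - q) ≤ c ^ ((r - q) / q) := by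
          have := Real.rpow_le_rpow (z := (r - q) / q) (by positivity) h1
            (div_nonneg (by linarith) hq.le)
          rwa [← Real.rpow_mul (norm_nonneg _), mul_div_cancel₀ _ hq.ne'] at this
        calc ‖μ.1 i x‖ ^ r = ‖μ.1 i x‖ ^ q * ‖μ.1 i x‖ ^ (r - q) := by
              rw [← Real.rpow_add_of_nonneg (norm_nonneg _) hq.le (by linarith)]
              congr 1; ring
          _ ≤ _ := by gcongr
    _ = (∑ x, ‖μ.1 i x‖ ^ q) * c ^ ((r - q) / q) := by rw [Finset.sum_mul]
    _ ≤ _ := by gcongr; exact hμ i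

/-- Sections of `𝓜_{<p}(S) = ⋃_{q<p} ⋃_c lim_i ℂ[S_i]_{ℓ^q ≤ c}` over a compact `T`: the continuous
maps from `T` to `lim_i ℂ[S_i]` that factor through `lim_i ℂ[S_i]_{ℓ^q ≤ c}` for some `0 < q < p`
and some `c`. -/
def IsLtSection (p : ℝ) {T : Type*} (g : T → Meas S) : Prop :=
  ∃ q : ℝ, 0 < q ∧ q < p ∧ ∃ c : ℝ, ∀ t, InBall q c (g t)

variable (S) in
/-- The sections of `𝓜_{<p}(S)` over `T`, as a `C(T, ℂ)`-submodule of `C(T, lim_i ℂ[S_i])`. -/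
def ltSections (p : Set.Ioc (0 : ℝ) 1) (T : Type u) [TopologicalSpace T] [CompactSpace T] :
    Submodule C(T, ℂ) C(T, Meas S) where
  carrier := {g | IsLtSection p.1 g}
  zero_mem' := ⟨p.1 / 2, half_pos p.2.1, half_lt_self p.2.1, 0,
    fun _ ↦ InBall.zero (half_pos p.2.1)⟩
  add_mem' := by
    rintro g h ⟨q, hq, hqp, c, hg⟩ ⟨r, hr, hrp, d, hh⟩
    refine ⟨max q r, lt_max_of_lt_left hq, max_lt hqp hrp, _, fun t ↦
      InBall.add (lt_max_of_lt_left hq) ((max_lt hqp hrp).le.trans p.2.2)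
        ((hg t).exponent hq (le_max_left q r)) ((hh t).exponent hr (le_max_right q r))⟩
  smul_mem' := by
    rintro z g ⟨q, hq, hqp, c, hg⟩
    exact ⟨q, hq, hqp, _, fun t ↦ (hg t).smul hq (ContinuousMap.norm_coe_le_norm z t)⟩

end Measures

section Lt

variable (p : Set.Ioc (0 : ℝ) 1) (S : Profinite.{u})

/-- `𝓜_{<p}(S)` as a subpresheaf of modules of `T ↦ C(T, lim_i ℂ[S_i])`. -/
noncomputable def ltSubmodule : (contPresheafOfModules (Meas S)).Submodule where
  obj T := ltSections S p T.unop
  map {T T'} f := by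
    rintro g ⟨q, hq, hqp, c, hg⟩
    exact ⟨q, hq, hqp, c, fun t ↦ hg (f.unop t)⟩

/-- The subpresheaf of sets underlying `ltSubmodule`. -/
def ltSubfunctor : Subfunctor
    (ContinuousMap.yonedaPresheaf.{u, u} (CompHausLike.compHausLikeToTop.{u} (fun _ ↦ True))
      (Meas S)) where
  obj T := {g | IsLtSection (T := T.unop) p.1 g.1}
  map {T T'} f := by
    rintro g ⟨q, hq, hqp, c, hg⟩
    exact ⟨q, hq, hqp, c, fun t ↦ hg (f.unop t)⟩

theorem ltSubfunctor_isSheaf :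
    Presieve.IsSheaf (coherentTopology CompHaus.{u}) (ltSubfunctor p S).toFunctor := by
  rw [Subfunctor.isSheaf_iff _ ((isSheaf_iff_isSheaf_of_type _ _).1 (isSheaf_yonedaPresheaf _))]
  intro U s hs
  rw [coherentTopology.mem_sieves_iff_hasEffectiveEpiFamily] at hs
  obtain ⟨α, _, Y, π, hπ, hY⟩ := hs
  have hsurj := ((CompHaus.effectiveEpiFamily_tfae Y π).out 0 2).1 hπ
  choose q hq hqp c hc using hY
  cases isEmpty_or_nonempty α
  · refine ⟨p.1 / 2, half_pos p.2.1, half_lt_self p.2.1, 0, fun t ↦ ?_⟩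
    obtain ⟨a, -⟩ := hsurj t
    exact isEmptyElim a
  · have := Fintype.ofFinite α
    let r := Finset.univ.sup' Finset.univ_nonempty q
    have hqr (a : α) : q a ≤ r := Finset.le_sup' q (Finset.mem_univ a)
    let d := Finset.univ.sup' Finset.univ_nonempty fun a ↦ c a * c a ^ ((r - q a) / q a)
    refine ⟨r, ?_, (Finset.sup'_lt_iff _).2 fun a _ ↦ hqp a, d, fun t ↦ ?_⟩
    · exact (hq (Classical.arbitrary α)).trans_le (hqr _)
    · obtain ⟨a, x, rfl⟩ := hsurj t
      exact ((hc a x).exponent (hq a) (hqr a)).mono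
        (Finset.le_sup' (fun a ↦ c a * c a ^ ((r - q a) / q a)) (Finset.mem_univ a))

/-- The condensed `ℂ`-vector space `𝓜_{<p}(S)`. -/
noncomputable def MLt : CondVect.{u} where
  val := (ltSubmodule p S).toPresheafOfModules
  isSheaf :=
    Presheaf.isSheaf_coherent_of_hasPullbacks_of_comp _ (CategoryTheory.forget AddCommGrpCat.{u})
      ((isSheaf_iff_isSheaf_of_type _ _).2 (ltSubfunctor_isSheaf p S))

open Classical in
/-- The Dirac measure at `s`. -/
noncomputable def dirac {S : Profinite.{u}} (s : S) : Meas S where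
  val i x := if i.proj s = x then 1 else 0
  property := by
    intro i j h y
    simp only
    rw [← DiscreteQuotient.ofLE_proj h s]
    simp [Finset.sum_ite_eq]

theorem continuous_dirac : Continuous (dirac : S → Meas S) := by
  classical
  refine Continuous.subtype_mk (continuous_pi fun i ↦ continuous_pi fun x ↦ ?_) _
  exact (continuous_of_discreteTopology (f := fun y : i ↦ if y = x then (1 : ℂ) else 0)).comp
    i.proj_continuous

theorem inBall_dirac {q : ℝ} (hq : 0 < q) (s : S) : InBall q 1 (dirac s) := by
  classical
  intro i
  refine le_of_eq ((Finset.sum_eq_single (i.proj s) ?_ ?_).trans ?_)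
  · intro x _ hx
    simp [dirac, hx.symm, Real.zero_rpow hq.ne']
  · simp
  · simp [dirac]

/-- The map of condensed sets `S → 𝓜_{<p}(S)` sending points to Dirac measures. -/
noncomputable def diracMap :
    topToCond.obj (TopCat.of S) ⟶ forgetCond.obj (MLt p S) where
  hom :=
    { app := fun T ↦ TypeCat.ofHom fun (g : C(T.unop, S)) ↦
        (⟨(⟨dirac, continuous_dirac S⟩ : C(S, Meas S)).comp g, p.1 / 2, half_pos p.2.1,
          half_lt_self p.2.1, 1, fun t ↦ inBall_dirac S (half_pos p.2.1) (g t)⟩ :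
            ltSections S p T.unop)
      naturality := fun _ _ _ ↦ rfl }

/-- `Extends ψ φ` says that the morphism `ψ : 𝓜_{<p}(S) → W` of condensed `ℂ`-vector spaces extends
the map of condensed sets `φ : S → W` along the Dirac map. -/
def Extends {p : Set.Ioc (0 : ℝ) 1} {S : Profinite.{u}} {W : CondVect.{u}}
    (ψ : MLt p S ⟶ W) (φ : topToCond.obj (TopCat.of S) ⟶ forgetCond.obj W) : Prop :=
  diracMap p S ≫ forgetCond.map ψ = φ

/-- A condensed `ℂ`-vector space `W` is `p`-liquid if for every profinite set `S`, every map of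
condensed sets `S → W` extends uniquely to a morphism `𝓜_{<p}(S) → W` of condensed `ℂ`-vector
spaces. -/
def IsLiquid (W : CondVect.{u}) : Prop :=
  ∀ (S : Profinite.{u}) (φ : topToCond.obj (TopCat.of S) ⟶ forgetCond.obj W),
    ∃! ψ : MLt p S ⟶ W, Extends ψ φ

/-- The one-point space. -/
abbrev pt : CompHaus.{u} := CompHaus.of PUnit.{u + 1}

end Lt

/-! ### The measure and the map attached to an entire function -/

/-- The profinite set `ℕ ∪ {∞}`. -/
abbrev NInf : Profinite.{u} := Profinite.of (ULift.{u} (OnePoint ℕ))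

/-- The point `n` of `ℕ ∪ {∞}`. -/
def NInf.ofNat (n : ℕ) : NInf.{u} := ULift.up (n : OnePoint ℕ)

section Entire

variable {f : ℂ → ℂ} {a b : ℕ → ℂ}

theorem summable_norm_rpow (hf : ∀ z, HasSum (fun n ↦ a n * z ^ n) (f z))
    (hb : ∀ n, b n ^ 2 = a n) {q : ℝ} (hq : 0 < q) : Summable fun n ↦ ‖b n‖ ^ q := by
  set R : ℝ := 2 ^ (2 / q) with hR
  have hR0 : 0 < R := by positivity
  have h1 := (hf (R : ℂ)).summable.tendsto_atTop_zero.norm.bddAbove_range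
  obtain ⟨C, hC⟩ := h1
  have hC' (n : ℕ) : ‖b n‖ ^ 2 * R ^ n ≤ C := by
    have := hC ⟨n, rfl⟩
    simpa [← hb, abs_of_pos hR0] using this
  have hC0 : 0 ≤ C := le_trans (by positivity) (hC' 0)
  refine Summable.of_nonneg_of_le (fun n ↦ by positivity) (fun n ↦ ?_)
    ((summable_geometric_of_lt_one (r := 1 / 2) (by norm_num) (by norm_num)).mul_left (C ^ (q / 2)))
  have h2 := Real.rpow_le_rpow (z := q / 2) (by positivity) (hC' n) (by positivity)
  rw [Real.mul_rpow (by positivity) (by positivity)] at h2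
  have h3 : (‖b n‖ ^ 2) ^ (q / 2) = ‖b n‖ ^ q := by
    rw [← Real.rpow_natCast, ← Real.rpow_mul (norm_nonneg _)]
    congr 1; push_cast; ring
  have h4 : (R ^ n) ^ (q / 2) = 2 ^ n := by
    rw [← Real.rpow_natCast, ← Real.rpow_mul hR0.le, hR, ← Real.rpow_mul (by norm_num),
      ← Real.rpow_natCast]
    congr 1; field_simp
  rw [h3, h4] at h2
  rw [div_pow, one_pow, mul_one_div, le_div_iff₀ (by positivity)]
  exact h2

theorem summable_coeff (hf : ∀ z, HasSum (fun n ↦ a n * z ^ n) (f z))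
    (hb : ∀ n, b n ^ 2 = a n) : Summable b :=
  Summable.of_norm (by simpa using summable_norm_rpow hf hb one_pos)

open Classical in
/-- The measure `μ_f = ∑ₙ bₙ δₙ` on `ℕ ∪ {∞}`, where `bₙ` is a square root of the Taylor
coefficient `aₙ` of `f`: it gives mass `bₙ` to `n` and mass `0` to `∞`. -/
noncomputable def entireMeas (hf : ∀ z, HasSum (fun n ↦ a n * z ^ n) (f z))
    (hb : ∀ n, b n ^ 2 = a n) : Meas NInf.{u} where
  val i x := ∑' n, if i.proj (NInf.ofNat n) = x then b n else 0
  property := by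
    have hs := summable_coeff hf hb
    intro i j h y
    have hs' (x : i) : Summable fun n ↦ if i.proj (NInf.ofNat n) = x then b n else 0 := by
      refine (hs.indicator {n | i.proj (NInf.ofNat n) = x}).congr fun n ↦ ?_
      simp [Set.indicator]
    rw [← Summable.tsum_finsetSum fun x _ ↦ hs' x]
    refine tsum_congr fun n ↦ ?_
    rw [← DiscreteQuotient.ofLE_proj h]
    simp [Finset.sum_ite_eq]

theorem inBall_entireMeas (hf : ∀ z, HasSum (fun n ↦ a n * z ^ n) (f z))
    (hb : ∀ n, b n ^ 2 = a n) {q : ℝ} (hq : 0 < q) (hq1 : q ≤ 1) :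
    InBall q (∑' n, ‖b n‖ ^ q) (entireMeas.{u} hf hb) := by
  classical
  have hs := summable_coeff hf hb
  have hsq := summable_norm_rpow hf hb hq
  have key (F : Finset ℕ) : InBall q (∑ n ∈ F, ‖b n‖ ^ q)
      (∑ n ∈ F, b n • dirac (NInf.ofNat.{u} n)) := by
    induction F using Finset.induction_on with
    | empty => simpa using InBall.zero hq
    | insert n F hn ih =>
      rw [Finset.sum_insert hn, Finset.sum_insert hn]
      refine InBall.add hq hq1 ?_ ih
      simpa using (inBall_dirac _ hq (NInf.ofNat.{u} n)).smul hq (le_refl ‖b n‖)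
  intro i
  have hlim : Tendsto (fun F : Finset ℕ ↦
      ∑ x, ‖(∑ n ∈ F, b n • dirac (NInf.ofNat.{u} n)).1 i x‖ ^ q) atTop
      (𝓝 (∑ x, ‖(entireMeas.{u} hf hb).1 i x‖ ^ q)) := by
    refine tendsto_finsetSum _ fun x _ ↦ ?_
    refine Tendsto.rpow_const (Tendsto.norm ?_) (Or.inr hq.le)
    have hs' : Summable fun n ↦ if i.proj (NInf.ofNat.{u} n) = x then b n else 0 := by
      refine (hs.indicator {n | i.proj (NInf.ofNat n) = x}).congr fun n ↦ ?_
      simp [Set.indicator]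
    refine hs'.hasSum.congr fun F ↦ ?_
    simp [dirac, Finset.sum_apply]
  exact le_of_tendsto' hlim fun F ↦ (key F i).trans (hsq.sum_le_tsum F fun _ _ ↦ by positivity)

/-- `μ_f` as a point of the condensed vector space `𝓜_{<p}(ℕ ∪ {∞})`. -/
noncomputable def entireMeasure (p : Set.Ioc (0 : ℝ) 1)
    (hf : ∀ z, HasSum (fun n ↦ a n * z ^ n) (f z)) (hb : ∀ n, b n ^ 2 = a n) :
    (MLt p NInf.{u}).val.obj (op pt) :=
  (⟨ContinuousMap.const _ (entireMeas hf hb), p.1 / 2, half_pos p.2.1, half_lt_self p.2.1, _,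
    fun _ ↦ inBall_entireMeas hf hb (half_pos p.2.1)
      ((half_lt_self p.2.1).le.trans p.2.2)⟩ : ltSections NInf.{u} p pt)

variable {V : Type u} [NormedAddCommGroup V] [NormedSpace ℂ V]

theorem tendsto_smul_pow (hf : ∀ z, HasSum (fun n ↦ a n * z ^ n) (f z))
    (hb : ∀ n, b n ^ 2 = a n) (T : V →L[ℂ] V) :
    Tendsto (fun n ↦ b n • T ^ n) atTop (𝓝 0) := by
  have h1 := (hf ((‖T‖ : ℂ) ^ 2)).summable.tendsto_atTop_zero.norm.sqrt
  rw [norm_zero, Real.sqrt_zero] at h1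
  refine squeeze_zero_norm' ?_ h1
  filter_upwards [eventually_gt_atTop 0] with n hn
  refine Real.le_sqrt_of_sq_le ?_
  rw [norm_smul, ← hb]
  simp only [norm_mul, norm_pow, Complex.norm_real, norm_norm, mul_pow]
  rw [← pow_mul, mul_comm 2 n, pow_mul]
  gcongr
  exact norm_pow_le' T hn

/-- The map `φ_{T,f} : ℕ ∪ {∞} → End(V)` with `n ↦ bₙ Tⁿ` and `∞ ↦ 0`. -/
noncomputable def phi (hf : ∀ z, HasSum (fun n ↦ a n * z ^ n) (f z))
    (hb : ∀ n, b n ^ 2 = a n) (T : V →L[ℂ] V) : C(NInf.{u}, V →L[ℂ] V) :=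
  (OnePoint.continuousMapMkNat (fun n ↦ b n • T ^ n) 0 (tendsto_smul_pow hf hb T)).comp
    ⟨ULift.down, continuous_uliftDown⟩

variable (V) in
/-- The Banach space `End(V)` of bounded operators as a condensed `ℂ`-vector space. -/
noncomputable abbrev condEnd : CondVect.{u} := condOfTop (V →L[ℂ] V)

/-- `φ_{T,f}` as a map of condensed sets. -/
noncomputable def condPhi (hf : ∀ z, HasSum (fun n ↦ a n * z ^ n) (f z))
    (hb : ∀ n, b n ^ 2 = a n) (T : V →L[ℂ] V) :
    topToCond.obj (TopCat.of NInf.{u}) ⟶ forgetCond.obj (condEnd V) :=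
  (topToCond.map (TopCat.ofHom (phi hf hb T)) :
    topToCond.obj (TopCat.of NInf.{u}) ⟶ topToCond.obj (TopCat.of (V →L[ℂ] V)))

/-- The value of a morphism `ψ : M → End(V)` at a point `μ ∈ M(*)`, as a bounded operator. -/
noncomputable def evalAt {M : CondVect.{u}} (ψ : M ⟶ condEnd V) (μ : M.val.obj (op pt)) :
    V →L[ℂ] V :=
  (show C(PUnit.{u + 1}, V →L[ℂ] V) from ψ.val.app (op pt) μ) PUnit.unit

end Entire

end Liquid

namespace Liquid

/-! ### Integration of continuous Banach-valued functions against measures in ℓ^q balls. -/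

section Integral

variable {S : Profinite.{u}}

/-! The extension of `φ : S → B` to measures is integration. For `q ≤ 1` an ℓ^q bound gives a bound
on total variation, and `φ` varies little on the classes of a fine enough finite quotient, so
Riemann sums converge uniformly on each ℓ^q ball (`uniformCauchySeqOn_riemannSum`). The integral is
therefore continuous on each ball, and it defines a morphism `𝓜_{<p}(S) → B`.

Uniqueness (`appSections_eq_integral`) uses that each ball is compact, hence itself a test object
carrying a tautological section, through which every section bounded by that ball factors. A
morphism `ψ` evaluated there is a continuous function on the ball. Every measure in the ball is a
limit, inside the same ball, of finite combinations of Dirac measures, on which linearity and the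
values on Dirac measures determine `ψ`. So every extension is the integral.

Finally, the partial sums of `∑ bₙ δₙ` converge to `μ_f` inside an ℓ^1 ball, so the integral of `n ↦
bₙ Tⁿ` is `∑ bₙ² Tⁿ`. -/

theorem InBall.sum_norm_le {q c : ℝ} (hq : 0 < q) (hq1 : q ≤ 1) {μ : Meas S}
    (hμ : InBall q c μ) (i : DiscreteQuotient S) :
    ∑ x, ‖μ.1 i x‖ ≤ c * c ^ ((1 - q) / q) := by
  simpa using hμ.exponent hq hq1 i

/-- A chosen point of the class `x`. -/
noncomputable def rep (i : DiscreteQuotient S) (x : i) : S := (i.proj_surjective x).choose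

@[simp]
theorem proj_rep (i : DiscreteQuotient S) (x : i) : i.proj (rep i x) = x :=
  (i.proj_surjective x).choose_spec

/-- `φ` is uniformly within `ε / 2` of a function factoring through a locally constant map to a
finite set; the fibres of that map form the partition. -/
theorem exists_discreteQuotient_dist_le {B : Type*} [PseudoMetricSpace B] (φ : C(S, B))
    {ε : ℝ} (hε : 0 < ε) :
    ∃ i : DiscreteQuotient S, ∀ s t, i.proj s = i.proj t → dist (φ s) (φ t) ≤ ε := by
  have hU : {x : B × B | dist x.1 x.2 < ε / 2} ∈ 𝓝ˢ (Set.diagonal B) := by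
    refine (IsOpen.mem_nhdsSet ?_).2 ?_
    · exact isOpen_lt (by fun_prop) continuous_const
    · rintro ⟨x, y⟩ (rfl : x = y)
      simpa using hε
  obtain ⟨n, g, h, hg, hgh⟩ := ContinuousMap.exists_finite_approximation_of_mem_nhds_diagonal φ hU
  have hloc : IsLocallyConstant g := (IsLocallyConstant.iff_continuous g).2 hg
  refine ⟨(⟨g, hloc⟩ : LocallyConstant S (Fin n)).discreteQuotient, fun s t hst ↦ ?_⟩
  have hgst : g s = g t := congrArg (⟨g, hloc⟩ : LocallyConstant S (Fin n)).lift hst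
  have h1 : dist (φ s) (h (g s)) < ε / 2 := hgh s
  have h2 : dist (φ t) (h (g t)) < ε / 2 := hgh t
  rw [← hgst, dist_comm] at h2
  linarith [dist_triangle (φ s) (h (g s)) (φ t)]

theorem meas_continuous_apply (i : DiscreteQuotient S) (x : i) :
    Continuous fun μ : Meas S ↦ μ.1 i x :=
  (continuous_apply x).comp ((continuous_apply i).comp continuous_subtype_val)

section RiemannSum

variable {B : Type*} [AddCommGroup B] [Module ℂ B] [TopologicalSpace B]
  [IsTopologicalAddGroup B] [ContinuousSMul ℂ B]

/-- The Riemann sum of `φ` against `μ` for the partition `i` of `S`. -/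
noncomputable def riemannSum (φ : S → B) (i : DiscreteQuotient S) : Meas S →L[ℂ] B where
  toFun μ := ∑ x, μ.1 i x • φ (rep i x)
  map_add' μ ν := by simp [add_smul, Finset.sum_add_distrib]
  map_smul' c μ := by simp [Finset.smul_sum, mul_smul]
  cont := continuous_finsetSum _ fun x _ ↦ (meas_continuous_apply i x).smul continuous_const

theorem riemannSum_apply (φ : S → B) (i : DiscreteQuotient S) (μ : Meas S) :
    riemannSum φ i μ = ∑ x, μ.1 i x • φ (rep i x) := rfl

theorem riemannSum_dirac (φ : S → B) (i : DiscreteQuotient S) (s : S) :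
    riemannSum φ i (dirac s) = φ (rep i (i.proj s)) := by
  classical
  simp [riemannSum_apply, dirac]

/-- The mass of a class is the sum of the masses of the classes refining it. This puts Riemann sums
for two partitions over the same index set, ready for termwise comparison. -/
theorem riemannSum_eq_of_le (φ : S → B) {i j : DiscreteQuotient S} (h : j ≤ i) (μ : Meas S) :
    riemannSum φ i μ = ∑ x, μ.1 j x • φ (rep i (DiscreteQuotient.ofLE h x)) := by
  classical
  rw [riemannSum_apply, ← Finset.sum_fiberwise (s := Finset.univ) (g := DiscreteQuotient.ofLE h)]
  refine Finset.sum_congr rfl fun y _ ↦ ?_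
  rw [← μ.2 j i h y, Finset.sum_smul]
  refine Finset.sum_congr (by congr!) fun x hx ↦ ?_
  rw [(Finset.mem_filter.1 hx).2]

end RiemannSum

/-- For `q ≤ 1` the q-th power of the norm is subadditive, so the bound holds even when some points
`s n` coincide or share a class. -/
theorem inBall_sum_smul_dirac {ι : Type*} {q : ℝ} (hq : 0 < q) (hq1 : q ≤ 1) (F : Finset ι)
    (z : ι → ℂ) (s : ι → S) :
    InBall q (∑ n ∈ F, ‖z n‖ ^ q) (∑ n ∈ F, z n • dirac (s n)) := by
  classical
  induction F using Finset.induction_on with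
  | empty => simpa using InBall.zero hq
  | insert n F hn ih =>
    rw [Finset.sum_insert hn, Finset.sum_insert hn]
    refine InBall.add hq hq1 ?_ ih
    simpa using (inBall_dirac _ hq (s n)).smul hq (le_refl ‖z n‖)

/-- With `φ = dirac` the Riemann sum is a discretisation of `μ`. It stays in the very same ball,
which lets the uniqueness argument take place inside one compact set. -/
theorem InBall.riemannSum_dirac {q c : ℝ} (hq : 0 < q) (hq1 : q ≤ 1) {μ : Meas S}
    (hμ : InBall q c μ) (i : DiscreteQuotient S) : InBall q c (riemannSum dirac i μ) :=
  (inBall_sum_smul_dirac hq hq1 _ _ _).mono (hμ i)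

theorem riemannSum_dirac_apply_of_le (μ : Meas S) {i j : DiscreteQuotient S} (h : i ≤ j) :
    (riemannSum dirac i μ).1 j = μ.1 j := by
  classical
  ext y
  rw [← μ.2 i j h y, riemannSum_apply, Finset.sum_filter]
  simp only [AddSubmonoidClass.coe_finsetSum, Finset.sum_apply, Submodule.coe_smul, Pi.smul_apply,
    smul_eq_mul]
  refine Finset.sum_congr rfl fun x _ ↦ ?_
  simp only [dirac, ← DiscreteQuotient.ofLE_proj h, proj_rep]
  split_ifs <;> simp

/-- Each coordinate is eventually constant. Finer quotients are smaller, so refinement is the filter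
`atBot`. -/
theorem tendsto_riemannSum_dirac (μ : Meas S) :
    Tendsto (fun i ↦ riemannSum dirac i μ) atBot (𝓝 μ) := by
  rw [tendsto_subtype_rng, tendsto_pi_nhds]
  intro j
  refine tendsto_const_nhds.congr' ?_
  filter_upwards [eventually_le_atBot j] with i hi
  exact (riemannSum_dirac_apply_of_le μ hi).symm

/-- Tychonoff: the ball is closed in a product of discs of radius `c ^ q⁻¹`. -/
theorem isCompact_inBall {q c : ℝ} (hq : 0 < q) : IsCompact {μ : Meas S | InBall q c μ} := by
  classical
  have hcl : IsClosed (Meas S : Set (∀ i : DiscreteQuotient S, i → ℂ)) := by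
    have : (Meas S : Set (∀ i : DiscreteQuotient S, i → ℂ)) =
        ⋂ (i : DiscreteQuotient S) (j : DiscreteQuotient S) (h : i ≤ j) (y : j),
          {μ | ∑ x with DiscreteQuotient.ofLE h x = y, μ i x = μ j y} := by
      ext μ
      simp only [Set.mem_iInter, Set.mem_ofPred_eq]
      refine forall₄_congr fun i j h y ↦ ?_
      congr!
    rw [this]
    refine isClosed_iInter fun i ↦ isClosed_iInter fun j ↦ isClosed_iInter fun h ↦
      isClosed_iInter fun y ↦ isClosed_eq (continuous_finsetSum _ fun x _ ↦ ?_) ?_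
    all_goals fun_prop
  have hball : IsClosed {μ : Meas S | InBall q c μ} := by
    simp only [InBall, Set.ofPred_forall]
    refine isClosed_iInter fun i ↦ isClosed_le (continuous_finsetSum _ fun x _ ↦ ?_)
      continuous_const
    exact (meas_continuous_apply i x).norm.rpow_const fun _ ↦ Or.inr hq.le
  have hcpt : IsCompact (Set.univ.pi fun i : DiscreteQuotient S ↦
      Set.univ.pi fun _ : i ↦ Metric.closedBall (0 : ℂ) (c ^ q⁻¹)) :=
    isCompact_univ_pi fun i ↦ isCompact_univ_pi fun x ↦ isCompact_closedBall _ _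
  refine (hcl.isClosedEmbedding_subtypeVal.isCompact_preimage hcpt).of_isClosed_subset hball ?_
  intro μ hμ
  simp only [Set.mem_preimage, Set.mem_univ_pi, mem_closedBall_zero_iff]
  intro i x
  have h1 : ‖μ.1 i x‖ ^ q ≤ c :=
    (Finset.single_le_sum (f := fun x ↦ ‖μ.1 i x‖ ^ q) (fun _ _ ↦ by positivity)
      (Finset.mem_univ x)).trans (hμ i)
  simpa [← Real.rpow_mul (norm_nonneg _), hq.ne'] using
    Real.rpow_le_rpow (z := q⁻¹) (by positivity) h1 (by positivity)

variable {B : Type*} [NormedAddCommGroup B] [NormedSpace ℂ B]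

theorem dist_riemannSum_le (φ : S → B) {i j : DiscreteQuotient S} (h : j ≤ i) {ε : ℝ}
    (hi : ∀ s t, i.proj s = i.proj t → dist (φ s) (φ t) ≤ ε) (μ : Meas S) :
    dist (riemannSum φ j μ) (riemannSum φ i μ) ≤ (∑ x, ‖μ.1 j x‖) * ε := by
  rw [riemannSum_eq_of_le φ h, riemannSum_apply, dist_eq_norm, ← Finset.sum_sub_distrib,
    Finset.sum_mul]
  refine (norm_sum_le _ _).trans (Finset.sum_le_sum fun x _ ↦ ?_)
  rw [← smul_sub, norm_smul, ← dist_eq_norm]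
  refine mul_le_mul_of_nonneg_left (hi _ _ ?_) (norm_nonneg _)
  rw [proj_rep, ← DiscreteQuotient.ofLE_proj h, proj_rep]

theorem uniformCauchySeqOn_riemannSum (φ : C(S, B)) {q : ℝ} (hq : 0 < q) (hq1 : q ≤ 1) (c : ℝ) :
    UniformCauchySeqOn (fun i μ ↦ riemannSum φ i μ) atBot {μ : Meas S | InBall q c μ} := by
  intro u hu
  obtain ⟨ε, hε, hu⟩ := Metric.mem_uniformity_dist.1 hu
  -- The first entry bounds the total variation on the ball; the maximum with `1` allows division by
  -- `C`.
  set C := max (c * c ^ ((1 - q) / q)) 1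
  have hC0 : 0 < C := lt_max_of_lt_right one_pos
  obtain ⟨i, hi⟩ := exists_discreteQuotient_dist_le φ (ε := ε / (3 * C)) (by positivity)
  filter_upwards [(eventually_le_atBot i).prod_mk (eventually_le_atBot i)] with m hm μ hμ
  have key (j : DiscreteQuotient S) (hj : j ≤ i) :
      dist (riemannSum φ j μ) (riemannSum φ i μ) ≤ ε / 3 := by
    refine (dist_riemannSum_le φ hj hi μ).trans ?_
    calc _ ≤ C * (ε / (3 * C)) := by
          gcongr
          exact (InBall.sum_norm_le hq hq1 hμ j).trans (le_max_left _ _)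
      _ = ε / 3 := by field_simp
  refine hu ?_
  linarith [dist_triangle_right (riemannSum φ m.1 μ) (riemannSum φ m.2 μ) (riemannSum φ i μ),
    key _ hm.1, key _ hm.2]

/-- The integral of `φ` against `μ`, as a limit of Riemann sums. -/
noncomputable def integral (φ : C(S, B)) (μ : Meas S) : B :=
  limUnder atBot fun i ↦ riemannSum φ i μ

theorem integral_dirac (φ : C(S, B)) (s : S) : integral φ (dirac s) = φ s := by
  refine Tendsto.limUnder_eq ?_
  simp only [riemannSum_dirac]
  refine Metric.tendsto_nhds.2 fun ε hε ↦ ?_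
  obtain ⟨i, hi⟩ := exists_discreteQuotient_dist_le φ (half_pos hε)
  filter_upwards [eventually_le_atBot i] with j hj
  refine (hi _ _ ?_).trans_lt (half_lt_self hε)
  rw [← DiscreteQuotient.ofLE_proj hj, proj_rep, DiscreteQuotient.ofLE_proj]

variable [CompleteSpace B]

theorem tendsto_riemannSum (φ : C(S, B)) {q c : ℝ} (hq : 0 < q) (hq1 : q ≤ 1) {μ : Meas S}
    (hμ : InBall q c μ) : Tendsto (fun i ↦ riemannSum φ i μ) atBot (𝓝 (integral φ μ)) :=
  ((uniformCauchySeqOn_riemannSum φ hq hq1 c).cauchy_map hμ).le_nhds_lim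

theorem continuousOn_integral (φ : C(S, B)) {q : ℝ} (hq : 0 < q) (hq1 : q ≤ 1) (c : ℝ) :
    ContinuousOn (integral φ) {μ : Meas S | InBall q c μ} :=
  ((uniformCauchySeqOn_riemannSum φ hq hq1 c).tendstoUniformlyOn_of_tendsto fun _ hμ ↦
    tendsto_riemannSum φ hq hq1 hμ).continuousOn
      (Frequently.of_forall fun i ↦ (riemannSum φ i).continuous.continuousOn)

/-- The exponents may differ, since only convergence of the two sequences of Riemann sums is needed.
-/
theorem integral_add (φ : C(S, B)) {q c r d : ℝ} (hq : 0 < q) (hq1 : q ≤ 1) (hr : 0 < r)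
    (hr1 : r ≤ 1) {μ ν : Meas S} (hμ : InBall q c μ) (hν : InBall r d ν) :
    integral φ (μ + ν) = integral φ μ + integral φ ν := by
  refine Tendsto.limUnder_eq ?_
  simpa using (tendsto_riemannSum φ hq hq1 hμ).add (tendsto_riemannSum φ hr hr1 hν)

theorem integral_smul (φ : C(S, B)) {q c : ℝ} (hq : 0 < q) (hq1 : q ≤ 1) (z : ℂ)
    {μ : Meas S} (hμ : InBall q c μ) : integral φ (z • μ) = z • integral φ μ := by
  refine Tendsto.limUnder_eq ?_
  simpa using (tendsto_riemannSum φ hq hq1 hμ).const_smul z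

theorem integral_sum_smul_dirac {ι : Type*} (φ : C(S, B)) (F : Finset ι)
    (z : ι → ℂ) (s : ι → S) :
    integral φ (∑ n ∈ F, z n • dirac (s n)) = ∑ n ∈ F, z n • φ (s n) := by
  classical
  induction F using Finset.induction_on with
  | empty => simpa using integral_smul φ one_pos le_rfl 0 (InBall.zero (S := S) one_pos)
  | insert n F hn ih =>
    rw [Finset.sum_insert hn, Finset.sum_insert hn,
      integral_add φ one_pos le_rfl one_pos le_rfl
        ((inBall_dirac _ one_pos (s n)).smul one_pos (le_refl ‖z n‖))
        (inBall_sum_smul_dirac one_pos le_rfl F z s),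
      integral_smul φ one_pos le_rfl _ (inBall_dirac _ one_pos (s n)), integral_dirac, ih]

end Integral

/-! ### Morphisms `𝓜_{<p}(S) → B`: existence and uniqueness of extensions. -/

section Morphism

variable {p : Set.Ioc (0 : ℝ) 1} {S : Profinite.{u}}
  {B : Type u} [NormedAddCommGroup B] [NormedSpace ℂ B]

theorem continuous_integral_comp [CompleteSpace B] (φ : C(S, B)) {T : Type*} [TopologicalSpace T]
    {g : T → Meas S} (hgc : Continuous g) (hg : IsLtSection p.1 g) :
    Continuous fun t ↦ integral φ (g t) := by
  obtain ⟨q, hq, hqp, c, hg⟩ := hg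
  exact (continuousOn_integral φ hq (hqp.le.trans p.2.2) c).comp_continuous hgc hg

variable (p) in
/-- Integration of `φ` on sections of `𝓜_{<p}(S)` over `T`. -/
noncomputable def integralSections [CompleteSpace B] (φ : C(S, B)) (T : Type u)
    [TopologicalSpace T] [CompactSpace T] : ltSections S p T →ₗ[C(T, ℂ)] C(T, B) where
  toFun g := ⟨fun t ↦ integral φ (g.1 t), continuous_integral_comp φ g.1.continuous g.2⟩
  map_add' := by
    rintro ⟨g, q, hq, hqp, c, hg⟩ ⟨h, r, hr, hrp, d, hh⟩
    ext t
    exact integral_add φ hq (hqp.le.trans p.2.2) hr (hrp.le.trans p.2.2) (hg t) (hh t)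
  map_smul' := by
    rintro z ⟨g, q, hq, hqp, c, hg⟩
    ext t
    exact integral_smul φ hq (hqp.le.trans p.2.2) (z t) (hg t)

variable (p) in
/-- Integration of `φ` as a morphism of condensed vector spaces `𝓜_{<p}(S) → B`. -/
noncomputable def integralHom [CompleteSpace B] (φ : C(S, B)) : MLt p S ⟶ condOfTop B where
  val :=
    { app := fun T ↦ ModuleCat.ofHom (X := (MLt p S).val.obj T) (Y := (condOfTop B).val.obj T)
        (integralSections p φ T.unop)
      naturality := fun _ ↦ rfl }

/-- The linear map induced by `ψ : 𝓜_{<p}(S) → B` on sections over `T`. -/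
noncomputable def appSections (ψ : MLt p S ⟶ condOfTop B) (T : CompHaus.{u}) :
    ltSections S p T →ₗ[C(T, ℂ)] C(T, B) :=
  (ψ.val.app (op T)).hom

theorem appSections_comp (ψ : MLt p S ⟶ condOfTop B) {T T' : CompHaus.{u}} (f : C(T', T))
    (g : ltSections S p T) (h : ltSections S p T') (hgh : ∀ t, h.1 t = g.1 (f t)) (t : T') :
    appSections ψ T' h t = appSections ψ T g (f t) := by
  let F : op T ⟶ op T' := Quiver.Hom.op (CompHausLike.ofHom _ f)
  have h1 : (MLt p S).val.map F g = h := Subtype.ext (ContinuousMap.ext fun t ↦ (hgh t).symm)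
  have h2 := PresheafOfModules.naturality_apply ψ.val F g
  rw [h1] at h2
  exact congrArg (fun k : C(T', B) ↦ k t) h2

theorem hom_ext_of_appSections {ψ ψ' : MLt p S ⟶ condOfTop B}
    (h : ∀ T g t, appSections ψ T g t = appSections ψ' T g t) : ψ = ψ' := by
  refine SheafOfModules.Hom.ext (PresheafOfModules.hom_ext fun T ↦ ?_)
  refine ModuleCat.hom_ext (LinearMap.ext fun g ↦ ?_)
  exact ContinuousMap.ext fun t ↦ h T.unop g t

/-- The continuous map underlying a map of condensed sets from `S` to a topological vector
space. -/
noncomputable def toContinuousMap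
    (φ : topToCond.obj (TopCat.of S) ⟶ forgetCond.obj (condOfTop B)) : C(S, B) :=
  (φ.hom.app (op (profiniteToCompHaus.obj S))).hom (ContinuousMap.id S)

/-- Yoneda: `S` is itself a test object, so `φ` is determined by the image of the identity. -/
theorem app_eq_comp (φ : topToCond.obj (TopCat.of S) ⟶ forgetCond.obj (condOfTop B))
    (T : CompHaus.{u}) (g : C(T, S)) :
    (show C(T, B) from φ.hom.app (op T) g) = (toContinuousMap φ).comp g :=
  congrArg (fun k ↦ k.hom (ContinuousMap.id S)) (φ.hom.naturality (Y := op T)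
    (X := op (profiniteToCompHaus.obj S)) (Quiver.Hom.op (CompHausLike.ofHom _ g)))

/-- The section of `𝓜_{<p}(S)` given by a continuous map to `S`. -/
noncomputable def diracSection (p : Set.Ioc (0 : ℝ) 1) {T : CompHaus.{u}} (g : C(T, S)) :
    ltSections S p T :=
  ⟨(⟨dirac, continuous_dirac S⟩ : C(S, Meas S)).comp g, p.1 / 2, half_pos p.2.1,
    half_lt_self p.2.1, 1, fun t ↦ inBall_dirac S (half_pos p.2.1) (g t)⟩

theorem extends_iff (ψ : MLt p S ⟶ condOfTop B)
    (φ : topToCond.obj (TopCat.of S) ⟶ forgetCond.obj (condOfTop B)) :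
    Extends ψ φ ↔ ∀ (T : CompHaus.{u}) (g : C(T, S)) (t : T),
      appSections ψ T (diracSection p g) t = toContinuousMap φ (g t) := by
  constructor
  · rintro rfl T g t
    have := app_eq_comp (diracMap p S ≫ forgetCond.map ψ) T g
    exact congrArg (fun k : C(T, B) ↦ k t) this
  · intro h
    refine Sheaf.hom_ext (NatTrans.ext (funext fun T ↦ ?_))
    ext g
    have := app_eq_comp φ T.unop g
    refine Eq.trans ?_ this.symm
    exact ContinuousMap.ext fun t ↦ h T.unop g t

theorem extends_integralHom [CompleteSpace B]
    (φ : topToCond.obj (TopCat.of S) ⟶ forgetCond.obj (condOfTop B)) :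
    Extends (integralHom p (toContinuousMap φ)) φ :=
  (extends_iff _ _).2 fun _ g t ↦ integral_dirac (toContinuousMap φ) (g t)

/-- A shortcut instance, without which the search for this scalar multiplication times out. -/
noncomputable instance (T : Type u) [TopologicalSpace T] [CompactSpace T] :
    SMul C(T, ℂ) (ltSections S p T) :=
  (ltSections S p T).module.toSMul

variable (p) in
/-- The constant section of `𝓜_{<p}(S)` with value a linear combination of Dirac measures. -/
noncomputable def sumDiracSection (T : CompHaus.{u}) {ι : Type*} (F : Finset ι) (z : ι → ℂ)
    (s : ι → S) : ltSections S p T :=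
  ∑ n ∈ F, ContinuousMap.const T (z n) • diracSection p (ContinuousMap.const T (s n))

theorem sumDiracSection_apply {T : CompHaus.{u}} {ι : Type*} (F : Finset ι) (z : ι → ℂ)
    (s : ι → S) (t : T) :
    (sumDiracSection p T F z s).1 t = ∑ n ∈ F, z n • dirac (s n) := by
  rw [sumDiracSection, AddSubmonoidClass.coe_finsetSum, ContinuousMap.sum_apply]
  rfl

theorem appSections_sumDiracSection {ψ : MLt p S ⟶ condOfTop B}
    {φ : topToCond.obj (TopCat.of S) ⟶ forgetCond.obj (condOfTop B)} (hψ : Extends ψ φ)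
    {T : CompHaus.{u}} {ι : Type*} (F : Finset ι) (z : ι → ℂ) (s : ι → S) (t : T) :
    appSections ψ T (sumDiracSection p T F z s) t =
      ∑ n ∈ F, z n • toContinuousMap φ (s n) := by
  rw [sumDiracSection, map_sum, ContinuousMap.sum_apply]
  refine Finset.sum_congr rfl fun n _ ↦ ?_
  rw [map_smul]
  exact congrArg (z n • ·) ((extends_iff ψ φ).1 hψ T (ContinuousMap.const _ (s n)) t)

theorem appSections_eq_integral {ψ : MLt p S ⟶ condOfTop B}
    {φ : topToCond.obj (TopCat.of S) ⟶ forgetCond.obj (condOfTop B)} (hψ : Extends ψ φ)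
    (T : CompHaus.{u}) (g : ltSections S p T) (t : T) :
    appSections ψ T g t = integral (toContinuousMap φ) (g.1 t) := by
  obtain ⟨g, q, hq, hqp, c, hg⟩ := g
  have hq1 : q ≤ 1 := hqp.le.trans p.2.2
  have := isCompact_iff_compactSpace.1 (isCompact_inBall (S := S) (c := c) hq)
  -- The section `g` is the pullback along `G` of the tautological section over the ball `K`, so it
  -- suffices to evaluate `ψ` on the latter.
  let K : CompHaus.{u} := CompHaus.of {μ : Meas S | InBall q c μ}
  let taut : ltSections S p K := ⟨⟨Subtype.val, continuous_subtype_val⟩, q, hq, hqp, c, fun k ↦ k.2⟩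
  let G : C(T, K) := ⟨fun t ↦ ⟨g t, hg t⟩, g.continuous.subtype_mk _⟩
  rw [appSections_comp ψ G taut _ fun _ ↦ rfl]
  set k : K := G t
  let d (i : DiscreteQuotient S) : K := ⟨riemannSum dirac i k.1, k.2.riemannSum_dirac hq hq1 i⟩
  have hd : Tendsto d atBot (𝓝 k) := tendsto_subtype_rng.2 (tendsto_riemannSum_dirac k.1)
  have h1 := ((appSections ψ K taut).continuous.tendsto k).comp hd
  have h2 (i : DiscreteQuotient S) :
      appSections ψ K taut (d i) = riemannSum (toContinuousMap φ) i k.1 := by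
    have h3 := appSections_comp ψ (ContinuousMap.const T (d i)) taut
      -- Pulling the tautological section back along the constant map at `d i` gives a combination
      -- of Dirac sections, where linearity applies.
      (sumDiracSection p T Finset.univ (k.1.1 i) (rep i)) (sumDiracSection_apply _ _ _) t
    exact h3.symm.trans (appSections_sumDiracSection hψ _ _ _ _)
  refine (Tendsto.limUnder_eq ?_).symm
  exact h1.congr h2

theorem isLiquid_condOfTop [CompleteSpace B] : IsLiquid p (condOfTop B) := fun _ φ ↦
  ⟨integralHom p (toContinuousMap φ), extends_integralHom φ, fun ψ hψ ↦
    hom_ext_of_appSections fun T g t ↦ by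
      rw [appSections_eq_integral hψ, appSections_eq_integral (extends_integralHom φ)]⟩

end Morphism

/-! ### The measure of an entire function and its integral. -/

section Entire

variable {f : ℂ → ℂ} {a b : ℕ → ℂ}

theorem hasSum_entireMeas (hf : ∀ z, HasSum (fun n ↦ a n * z ^ n) (f z))
    (hb : ∀ n, b n ^ 2 = a n) :
    HasSum (fun n ↦ b n • dirac (NInf.ofNat.{u} n)) (entireMeas.{u} hf hb) := by
  classical
  rw [HasSum, tendsto_subtype_rng, tendsto_pi_nhds]
  refine fun i ↦ tendsto_pi_nhds.2 fun x ↦ ?_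
  have hs' : Summable fun n ↦ if i.proj (NInf.ofNat.{u} n) = x then b n else 0 := by
    refine ((summable_coeff hf hb).indicator {n | i.proj (NInf.ofNat n) = x}).congr fun n ↦ ?_
    simp [Set.indicator]
  refine hs'.hasSum.congr fun F ↦ ?_
  simp [dirac, Finset.sum_apply]

theorem hasSum_integral_entireMeas {B : Type*} [NormedAddCommGroup B] [NormedSpace ℂ B]
    [CompleteSpace B] (φ : C(NInf.{u}, B)) (hf : ∀ z, HasSum (fun n ↦ a n * z ^ n) (f z))
    (hb : ∀ n, b n ^ 2 = a n) :
    HasSum (fun n ↦ b n • φ (NInf.ofNat n)) (integral φ (entireMeas hf hb)) := by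
  have hs := summable_norm_rpow hf hb one_pos
  have h1 := continuousOn_integral φ one_pos le_rfl _ _ (inBall_entireMeas hf hb one_pos le_rfl)
  -- The integral is known to be continuous only on balls, so the partial sums must be kept in one;
  -- the full sum of the norms serves as a common radius.
  have h2 : Tendsto (fun F : Finset ℕ ↦ ∑ n ∈ F, b n • dirac (NInf.ofNat.{u} n)) atTop
      (𝓝[{μ | InBall 1 (∑' n, ‖b n‖ ^ (1 : ℝ)) μ}] (entireMeas.{u} hf hb)) :=
    tendsto_nhdsWithin_iff.2 ⟨hasSum_entireMeas hf hb, Eventually.of_forall fun F ↦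
      (inBall_sum_smul_dirac one_pos le_rfl F _ _).mono
        (hs.sum_le_tsum F fun _ _ ↦ by positivity)⟩
  exact (h1.tendsto.comp h2).congr fun F ↦ integral_sum_smul_dirac φ F _ _

variable {V : Type u} [NormedAddCommGroup V] [NormedSpace ℂ V]

theorem evalAt_entireMeasure [CompleteSpace V] (p : Set.Ioc (0 : ℝ) 1)
    (hf : ∀ z, HasSum (fun n ↦ a n * z ^ n) (f z)) (hb : ∀ n, b n ^ 2 = a n) (T : V →L[ℂ] V)
    {ψ : MLt p NInf.{u} ⟶ condEnd V} (hψ : Extends ψ (condPhi hf hb T)) :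
    evalAt ψ (entireMeasure p hf hb) = integral (phi hf hb T) (entireMeas hf hb) :=
  appSections_eq_integral hψ pt (entireMeasure p hf hb) PUnit.unit

end Entire

end Liquid

theorem mainTheorem2 (p : Set.Ioc (0 : ℝ) 1)
    {V : Type u} [NormedAddCommGroup V] [NormedSpace ℂ V] [CompleteSpace V] (T : V →L[ℂ] V)
    (f : ℂ → ℂ) (a : ℕ → ℂ) (hf : ∀ z, HasSum (fun n ↦ a n * z ^ n) (f z))
    (b : ℕ → ℂ) (hb : ∀ n, b n ^ 2 = a n) :
    Liquid.IsLiquid p (Liquid.condEnd V) ∧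
    ∃ φt : Liquid.MLt p Liquid.NInf.{u} ⟶ Liquid.condEnd V,
      (Liquid.Extends φt (Liquid.condPhi hf hb T) ∧
        ∀ ψ : Liquid.MLt p Liquid.NInf.{u} ⟶ Liquid.condEnd V,
          Liquid.Extends ψ (Liquid.condPhi hf hb T) → ψ = φt) ∧
      HasSum (fun n ↦ a n • T ^ n) (Liquid.evalAt φt (Liquid.entireMeasure p hf hb)) := by
  refine ⟨Liquid.isLiquid_condOfTop, ?_⟩
  obtain ⟨φt, h1, h2⟩ := Liquid.isLiquid_condOfTop (p := p) (B := V →L[ℂ] V) Liquid.NInf.{u}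
    (Liquid.condPhi hf hb T)
  refine ⟨φt, ⟨h1, h2⟩, ?_⟩
  rw [Liquid.evalAt_entireMeasure p hf hb T h1]
  refine (Liquid.hasSum_integral_entireMeas (Liquid.phi hf hb T) hf hb).congr_fun ?_
  intro n
  -- One factor `b n` is the mass of the measure at `n`, the other comes from the value of `phi`
  -- there.
  change _ = b n • b n • T ^ n
  rw [smul_smul, ← sq, hb]
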